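/- Let $n\ge 0$ be an integer, write points of $\mathbf{R}^{n+1}$ as $w=(w^0,\vec w)$ with $\vec w=(w^1,\dots,w^n)\in\mathbf{R}^n$, and let $$C_O:=\Big\{w\in\mathbf{R}^{n+1}:\ w^0=|\vec w|=\sqrt{\textstyle\sum_{i=1}^n (w^i)^2}\Big\}.$$ A function $\varphi:C_O\to\mathbf{R}$ is said to be $C^k(C_O)$ (where $k\in\{0,1,2,\dots\}$), respectively $C_O$-smooth, respectively $C_O$-analytic, if there are functions $\hat\varphi,\check\varphi:\mathbf{R}^n\to\mathbf{R}$, both of class $C^k$, respectively both smooth ($C^\infty$), respectively both real-analytic, such that $$\varphi(w)=\hat\varphi(\vec w)+r\,\check\varphi(\vec w)\quad\text{for all } w\in C_O,\qquad r:=|\vec w|.$$ **Proposition.** Let $\varphi:C_O\to\mathbf{R}$ be any function. 1. For every integer $k\ge 0$, there is a $C^k$ function $f:\mathbf{R}^{n+1}\to\mathbf{R}$ with $f|_{C_O}=\varphi$ if and only if $\varphi$ is $C^k(C_O)$. 2. There is a smooth function $f:\mathbf{R}^{n+1}\to\mathbf{R}$ with $f|_{C_O}=\varphi$ if and only if $\varphi$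 is $C_O$-smooth. 3. There is a real-analytic function $f:\mathbf{R}^{n+1}\to\mathbf{R}$ with $f|_{C_O}=\varphi$ if and only if $\varphi$ is $C_O$-analytic. -/

import Mathlib

open scoped ContDiff

/-- The future light cone `C_O = {w ∈ ℝⁿ⁺¹ : w⁰ = √(∑ᵢ (wⁱ)²)}` with vertex at the origin. The
coordinate `w 0` is `w⁰`, and `w i.succ`, `i : Fin n`, are the spatial coordinates. -/
def lightCone (n : ℕ) : Set (EuclideanSpace ℝ (Fin (n + 1))) :=
  {w | w 0 = Real.sqrt (∑ i : Fin n, (w i.succ) ^ 2)}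

/-- The spatial part `(w¹, …, wⁿ)` of `w = (w⁰, w¹, …, wⁿ)`, a vector of Euclidean `ℝⁿ`. Its
restriction to `lightCone n` is the coordinatisation of the cone. -/
noncomputable def spatialPart {n : ℕ} (w : EuclideanSpace ℝ (Fin (n + 1))) :
    EuclideanSpace ℝ (Fin n) :=
  WithLp.toLp 2 (fun i : Fin n => w i.succ)

/-- `φ = φ₁ + r φ₂` on the cone, where `φ₁` and `φ₂` are functions of the spatial variable
satisfying `P`, and `r` is the Euclidean norm of the spatial variable. -/
def HasConeDecomposition {n : ℕ} (P : (EuclideanSpace ℝ (Fin n) → ℝ) → Prop)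
    (φ : lightCone n → ℝ) : Prop :=
  ∃ φ₁ φ₂ : EuclideanSpace ℝ (Fin n) → ℝ, P φ₁ ∧ P φ₂ ∧
    ∀ w : lightCone n,
      φ w = φ₁ (spatialPart (w : EuclideanSpace ℝ (Fin (n + 1)))) +
        ‖spatialPart (w : EuclideanSpace ℝ (Fin (n + 1)))‖ *
          φ₂ (spatialPart (w : EuclideanSpace ℝ (Fin (n + 1))))

/-- `φ ∈ C^k(C_O)`. -/
def IsConeCk {n : ℕ} (k : ℕ) (φ : lightCone n → ℝ) : Prop :=
  HasConeDecomposition (fun g => ContDiff ℝ k g) φ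

/-- `φ` is `C_O`-smooth. -/
def IsConeSmooth {n : ℕ} (φ : lightCone n → ℝ) : Prop :=
  HasConeDecomposition (fun g => ContDiff ℝ ∞ g) φ

/-- `φ` is `C_O`-analytic. -/
def IsConeAnalytic {n : ℕ} (φ : lightCone n → ℝ) : Prop :=
  HasConeDecomposition (fun g => AnalyticOnNhd ℝ g Set.univ) φ

-- A decomposition extends off the cone as `φ₁ + w⁰ φ₂`. For the converse, the aim is to write `f =
-- φ₁ + r φ₂` on the double cone `r² = ‖x‖²`, where `φ₁` and `r φ₂` are the even and odd parts of
-- `f` in `r`; only the vertex is critical.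
--
-- For analytic `f`, substitute for `w⁰` a two-by-two matrix with eigenvalues `±‖x‖` whose entries
-- are polynomial in `x`. Evaluating the power series of `f` on this matrix gives an operator
-- analytic in `x`, and reading it on the eigenvector of eigenvalue `r` yields the splitting
-- (`AnalyticAt.exists_local_coneSplitting`).
--
-- For `C^k` functions, subtract the Taylor polynomial at the vertex, which splits analytically. The
-- remainder is flat of order `k`, and flatness survives composition with `x ↦ (‖x‖, x)`, so on the
-- future cone it is a `C^k` function of `x` and joins `φ₁` (`IsSymbol.contDiff`).
--
-- Such splittings may vary with `k`. In the smooth case the double cone makes them unique, at the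
-- price of one derivative, which is harmless.

universe u

/-! ### Symmetry of higher derivatives and Taylor polynomials. -/

/-- The iterated derivative of a `C^(n+1)` function is invariant under exchanging two adjacent
arguments. -/
theorem ContDiff.iteratedFDeriv_comp_swap {E : Type u} [NormedAddCommGroup E] [NormedSpace ℝ E]
    (n : ℕ) {F : Type u} [NormedAddCommGroup F] [NormedSpace ℝ F] {f : E → F}
    (hf : ContDiff ℝ (n + 1 : ℕ) f) (i : Fin n) (x : E) (v : Fin (n + 1) → E) :
    iteratedFDeriv ℝ (n + 1) f x (v ∘ Equiv.swap i.castSucc i.succ) =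
      iteratedFDeriv ℝ (n + 1) f x v := by
  induction n generalizing F x with
  | zero => exact i.elim0
  | succ n ih =>
    have hf' : ContDiff ℝ (n + 1 : ℕ) (fderiv ℝ f) :=
      hf.fderiv_right (by norm_cast)
    have hf'' : ContDiff ℝ (n + 1 : ℕ) f := hf.of_le (by norm_cast; omega)
    -- A swap avoiding argument 0 is treated by freezing that argument; the swap of 0 and 1 by
    -- freezing the last argument and passing to `fderiv ℝ f`, down to the symmetry of second
    -- derivatives.
    induction i using Fin.cases with
    | succ j =>
      have hd : DifferentiableAt ℝ (iteratedFDeriv ℝ (n + 1) f) x :=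
        hf.differentiable_iteratedFDeriv (by norm_cast; omega) x
      rw [hd.iteratedFDeriv_succ_apply_left', hd.iteratedFDeriv_succ_apply_left']
      have h0 : (v ∘ Equiv.swap j.succ.castSucc j.succ.succ) 0 = v 0 := by
        rw [Function.comp_apply, Equiv.swap_apply_of_ne_of_ne]
        · simp [Fin.ext_iff]
        · simp [Fin.ext_iff]
      have ht : Fin.tail (v ∘ Equiv.swap j.succ.castSucc j.succ.succ) =
          Fin.tail v ∘ Equiv.swap j.castSucc j.succ := by
        funext l
        simp only [Fin.tail, Function.comp_apply]
        rw [← Fin.succ_castSucc, (Fin.succ_injective (n + 1)).swap_apply]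
      rw [h0, ht]
      simp only [ih hf'' j]
    | zero =>
      rw [iteratedFDeriv_succ_apply_right (v ∘ _), iteratedFDeriv_succ_apply_right v]
      cases n with
      | zero =>
        have hs : IsSymmSndFDerivAt ℝ f x :=
          hf.contDiffAt.isSymmSndFDerivAt (by simp)
        have := hs.eq (v 0) (v 1)
        simpa [iteratedFDeriv_succ_apply_right, Fin.init] using this.symm
      | succ n =>
        have h1 : (v ∘ Equiv.swap (0 : Fin (n + 2)).castSucc (0 : Fin (n + 2)).succ)
            (Fin.last (n + 1 + 1)) = v (Fin.last (n + 1 + 1)) := by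
          rw [Function.comp_apply, Equiv.swap_apply_of_ne_of_ne] <;>
            simp [Fin.ext_iff]
        have h2 : Fin.init (v ∘ Equiv.swap (0 : Fin (n + 2)).castSucc (0 : Fin (n + 2)).succ) =
            Fin.init v ∘ Equiv.swap (0 : Fin (n + 1)).castSucc (0 : Fin (n + 1)).succ := by
          funext l
          simp only [Fin.init, Function.comp_apply]
          rw [← (Fin.castSucc_injective (n + 2)).swap_apply]
          simp
        rw [h1, h2, ih hf' 0]

/-- The `n`-th iterated derivative of a `C^n` function is symmetric. -/
theorem ContDiff.iteratedFDeriv_comp_perm {E F : Type u} [NormedAddCommGroup E] [NormedSpace ℝ E]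
    [NormedAddCommGroup F] [NormedSpace ℝ F] {n : ℕ} {f : E → F} (hf : ContDiff ℝ n f)
    (σ : Equiv.Perm (Fin n)) (x : E) (v : Fin n → E) :
    iteratedFDeriv ℝ n f x (v ∘ σ) = iteratedFDeriv ℝ n f x v := by
  cases n with
  | zero => rw [Subsingleton.elim (v ∘ σ) v]
  | succ n =>
    have hσ : σ ∈ Submonoid.closure
        (Set.range fun i : Fin n ↦ Equiv.swap i.castSucc i.succ) := by
      rw [Equiv.Perm.mclosure_swap_castSucc_succ]; trivial
    induction hσ using Submonoid.closure_induction generalizing v with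
    | mem τ hτ =>
      obtain ⟨i, rfl⟩ := hτ
      exact hf.iteratedFDeriv_comp_swap n i x v
    | one => rfl
    | mul τ τ' _ _ h h' =>
      rw [Equiv.Perm.coe_mul, ← Function.comp_assoc, h', h]

/-- Every `C^k` function has the same derivatives of order at most `k` at the origin as some entire
analytic function, namely its Taylor polynomial. -/
theorem ContDiff.exists_analyticOnNhd_iteratedFDeriv_eq {E F : Type u} [NormedAddCommGroup E]
    [NormedSpace ℝ E] [NormedAddCommGroup F] [NormedSpace ℝ F] [CompleteSpace F] {k : ℕ}
    {f : E → F} (hf : ContDiff ℝ k f) :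
    ∃ P : E → F, AnalyticOnNhd ℝ P Set.univ ∧
      ∀ j ≤ k, iteratedFDeriv ℝ j P 0 = iteratedFDeriv ℝ j f 0 := by
  let p : FormalMultilinearSeries ℝ E F := fun j ↦
    if j ≤ k then ((j.factorial : ℝ)⁻¹) • iteratedFDeriv ℝ j f 0 else 0
  have hr : p.radius = ⊤ := p.radius_eq_top_of_forall_image_add_eq_zero (k + 1) fun m ↦
    if_neg (by omega)
  have hp : HasFPowerSeriesOnBall p.sum p 0 p.radius := p.hasFPowerSeriesOnBall (by simp [hr])
  refine ⟨p.sum, ?_, fun j hj ↦ ?_⟩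
  · have := hp.analyticOnNhd
    rwa [hr, Metric.eball_top] at this
  · ext v
    -- The derivative of the series is a sum over permutations of the arguments; by symmetry its
    -- `j!` terms agree and cancel the factorial in `p`.
    rw [hp.iteratedFDeriv_eq_sum_of_completeSpace]
    have hj' : ContDiff ℝ j f := hf.of_le (by exact_mod_cast hj)
    have (σ : Equiv.Perm (Fin j)) : p j (fun i ↦ v (σ i)) =
        ((j.factorial : ℝ)⁻¹) • iteratedFDeriv ℝ j f 0 v := by
      simp only [p, if_pos hj, smul_apply]
      exact congrArg _ (hj'.iteratedFDeriv_comp_perm σ 0 v)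
    simp only [this, Finset.sum_const, Finset.card_univ, Fintype.card_perm, Fintype.card_fin]
    rw [← Nat.cast_smul_eq_nsmul ℝ, smul_smul, mul_inv_cancel₀ (by positivity), one_smul]

/-! ### Symbol calculus at the origin. -/

open Filter Topology Asymptotics in
/-- `u = o(‖x‖ ^ s)` (if `o` is true) or `u = O(‖x‖ ^ s)` (if `o` is false) as `x → 0`, `x ≠ 0`. -/
def SymbolGrowth {E F : Type*} [NormedAddCommGroup E] [NormedAddCommGroup F] (o : Bool) (s : ℤ)
    (u : E → F) : Prop :=
  if o then u =o[𝓝[≠] 0] (fun x ↦ ‖x‖ ^ s) else u =O[𝓝[≠] 0] (fun x ↦ ‖x‖ ^ s)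

/-- The function `u` is `C^k` away from the origin, and its derivatives of order `j ≤ k` grow at
most like `‖x‖ ^ (s - j)` (more slowly than that, if `o` is true) at the origin. -/
def IsSymbol {E : Type} [NormedAddCommGroup E] [NormedSpace ℝ E] (o : Bool) :
    ℕ → ℤ → ∀ {F : Type} [NormedAddCommGroup F] [NormedSpace ℝ F], (E → F) → Prop
  | 0, s, _, _, _, u => ContinuousOn u {0}ᶜ ∧ SymbolGrowth o s u
  | k + 1, s, _, _, _, u => DifferentiableOn ℝ u {0}ᶜ ∧ SymbolGrowth o s u ∧
      IsSymbol o k (s - 1) (fderiv ℝ u)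

section Growth

open Filter Topology Asymptotics

variable {E F G H : Type*} [NormedAddCommGroup E] [NormedAddCommGroup F] [NormedAddCommGroup G]
  [NormedAddCommGroup H] {o : Bool} {s t : ℤ}

theorem SymbolGrowth.congr {u v : E → F} (hu : SymbolGrowth o s u) (h : Set.EqOn u v {0}ᶜ) :
    SymbolGrowth o s v := by
  have h' : u =ᶠ[𝓝[≠] 0] v := eventually_of_mem self_mem_nhdsWithin h
  cases o
  · exact IsBigO.congr' (by simpa [SymbolGrowth] using hu) h' EventuallyEq.rfl
  · exact IsLittleO.congr' (by simpa [SymbolGrowth] using hu) h' EventuallyEq.rfl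

theorem SymbolGrowth.zero : SymbolGrowth o s (fun _ : E ↦ (0 : F)) := by
  cases o
  · exact isBigO_zero _ _
  · exact isLittleO_zero _ _

theorem SymbolGrowth.add {u v : E → F} (hu : SymbolGrowth o s u) (hv : SymbolGrowth o s v) :
    SymbolGrowth o s (fun x ↦ u x + v x) := by
  cases o
  · exact IsBigO.add (by simpa [SymbolGrowth] using hu) (by simpa [SymbolGrowth] using hv)
  · exact IsLittleO.add (by simpa [SymbolGrowth] using hu) (by simpa [SymbolGrowth] using hv)

theorem SymbolGrowth.bilinear [NormedSpace ℝ F] [NormedSpace ℝ G] [NormedSpace ℝ H]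
    (B : F →L[ℝ] G →L[ℝ] H) {u : E → F} {v : E → G} (hu : SymbolGrowth o s u)
    (hv : SymbolGrowth false t v) : SymbolGrowth o (s + t) (fun x ↦ B (u x) (v x)) := by
  have hv' : v =O[𝓝[≠] 0] (fun x ↦ ‖x‖ ^ t) := hv
  have hB : (fun x ↦ B (u x) (v x)) =O[𝓝[≠] 0] (fun x ↦ ‖u x‖ * ‖v x‖) :=
    IsBigO.of_bound ‖B‖ (Eventually.of_forall fun x ↦ by
      simpa [mul_assoc] using B.le_opNorm₂ (u x) (v x))
  have hst : (fun x : E ↦ ‖x‖ ^ s * ‖x‖ ^ t) =ᶠ[𝓝[≠] 0] (fun x ↦ ‖x‖ ^ (s + t)) :=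
    eventually_of_mem self_mem_nhdsWithin fun x hx ↦ (zpow_add₀ (norm_ne_zero_iff.2 hx) s t).symm
  cases o
  · have hu' : u =O[𝓝[≠] 0] (fun x ↦ ‖x‖ ^ s) := hu
    exact hB.trans ((hu'.norm_left.mul hv'.norm_left).congr' EventuallyEq.rfl hst)
  · have hu' : u =o[𝓝[≠] 0] (fun x ↦ ‖x‖ ^ s) := by simpa [SymbolGrowth] using hu
    have := (hu'.norm_left.mul_isBigO hv'.norm_left).congr' EventuallyEq.rfl hst
    simpa [SymbolGrowth] using hB.trans_isLittleO this

theorem SymbolGrowth.comp {u : F → G} (hu : SymbolGrowth o s u) {ψ : E → F} {c : ℝ} (hc : 0 < c)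
    (hψ : ∀ x, ‖ψ x‖ = c * ‖x‖) : SymbolGrowth o s (fun x ↦ u (ψ x)) := by
  have hψ0 : Tendsto ψ (𝓝[≠] 0) (𝓝[≠] 0) := by
    refine tendsto_nhdsWithin_iff.2 ⟨?_, eventually_of_mem self_mem_nhdsWithin fun x hx ↦ ?_⟩
    · refine tendsto_zero_iff_norm_tendsto_zero.2 ?_
      simp only [hψ]
      have : Tendsto (fun x : E ↦ c * ‖x‖) (𝓝 0) (𝓝 (c * ‖(0 : E)‖)) :=
        (continuous_const.mul continuous_norm).tendsto 0
      rw [norm_zero, mul_zero] at this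
      exact this.mono_left nhdsWithin_le_nhds
    · have : ‖ψ x‖ ≠ 0 := by
        rw [hψ]
        exact mul_ne_zero hc.ne' (norm_ne_zero_iff.2 hx)
      exact norm_ne_zero_iff.1 this
  have hO : ((fun y ↦ ‖y‖ ^ s) ∘ ψ) =O[𝓝[≠] 0] (fun x : E ↦ ‖x‖ ^ s) := by
    have : ((fun y ↦ ‖y‖ ^ s) ∘ ψ) = fun x ↦ c ^ s * ‖x‖ ^ s := by
      funext x
      simp [hψ, mul_zpow]
    rw [this]
    exact isBigO_const_mul_self _ _ _
  cases o
  · have hu' : u =O[𝓝[≠] 0] (fun x ↦ ‖x‖ ^ s) := hu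
    exact (hu'.comp_tendsto hψ0).trans hO
  · have hu' : u =o[𝓝[≠] 0] (fun x ↦ ‖x‖ ^ s) := by simpa [SymbolGrowth] using hu
    have := (hu'.comp_tendsto hψ0).trans_isBigO hO
    simp only [SymbolGrowth, if_true]
    exact this

end Growth

section Symbol

open Filter Topology Asymptotics

variable {E F G H V : Type} [NormedAddCommGroup E] [NormedSpace ℝ E] [NormedAddCommGroup F]
  [NormedSpace ℝ F] [NormedAddCommGroup G] [NormedSpace ℝ G] [NormedAddCommGroup H]
  [NormedSpace ℝ H] [NormedAddCommGroup V] [NormedSpace ℝ V] {o : Bool} {k : ℕ} {s t : ℤ}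

theorem IsSymbol.growth {u : E → F} (hu : IsSymbol o k s u) : SymbolGrowth o s u := by
  cases k with
  | zero => exact hu.2
  | succ k => exact hu.2.1

theorem IsSymbol.continuousOn {u : E → F} (hu : IsSymbol o k s u) : ContinuousOn u {0}ᶜ := by
  cases k with
  | zero => exact hu.1
  | succ k => exact hu.1.continuousOn

theorem IsSymbol.of_succ {u : E → F} (hu : IsSymbol o (k + 1) s u) : IsSymbol o k s u := by
  induction k generalizing F s with
  | zero => exact ⟨hu.continuousOn, hu.growth⟩
  | succ k ih => exact ⟨hu.1, hu.2.1, ih hu.2.2⟩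

theorem IsSymbol.congr {u v : E → F} (hu : IsSymbol o k s u) (h : Set.EqOn u v {0}ᶜ) :
    IsSymbol o k s v := by
  induction k generalizing F s with
  | zero => exact ⟨hu.1.congr h.symm, hu.2.congr h⟩
  | succ k ih =>
    refine ⟨hu.1.congr h.symm, hu.2.1.congr h, ih hu.2.2 fun x hx ↦ ?_⟩
    exact (h.eventuallyEq_of_mem (isOpen_compl_singleton.mem_nhds hx)).fderiv_eq

theorem IsSymbol.differentiableAt {u : E → F} (hu : IsSymbol o (k + 1) s u) {x : E} (hx : x ≠ 0) :
    DifferentiableAt ℝ u x :=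
  (hu.1 x hx).differentiableAt (isOpen_compl_singleton.mem_nhds hx)

theorem IsSymbol.zero : IsSymbol o k s (fun _ : E ↦ (0 : F)) := by
  induction k generalizing F s with
  | zero => exact ⟨continuousOn_const, SymbolGrowth.zero⟩
  | succ k ih =>
    refine ⟨differentiableOn_const _, SymbolGrowth.zero, ?_⟩
    exact ih.congr fun x _ ↦ by simp

theorem IsSymbol.add {u v : E → F} (hu : IsSymbol o k s u) (hv : IsSymbol o k s v) :
    IsSymbol o k s (fun x ↦ u x + v x) := by
  induction k generalizing F s with
  | zero => exact ⟨hu.1.add hv.1, hu.2.add hv.2⟩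
  | succ k ih =>
    refine ⟨hu.1.add hv.1, hu.2.1.add hv.2.1, (ih hu.2.2 hv.2.2).congr fun x hx ↦ ?_⟩
    exact (fderiv_fun_add (hu.differentiableAt hx) (hv.differentiableAt hx)).symm

/-- Leibniz rule: differentiating either factor lowers the total order by one. Little-o in one
factor suffices. -/
theorem IsSymbol.bilinear (B : F →L[ℝ] G →L[ℝ] H) {u : E → F} {v : E → G}
    (hu : IsSymbol o k s u) (hv : IsSymbol false k t v) :
    IsSymbol o k (s + t) (fun x ↦ B (u x) (v x)) := by
  induction k generalizing F G H s t with
  | zero =>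
    exact ⟨(B.continuous.comp_continuousOn hu.1).clm_apply hv.1, hu.2.bilinear B hv.2⟩
  | succ k ih =>
    refine ⟨fun x hx ↦ ?_, hu.2.1.bilinear B hv.2.1, ?_⟩
    · exact (B.hasFDerivAt_of_bilinear (hu.differentiableAt hx).hasFDerivAt
        (hv.differentiableAt hx).hasFDerivAt).differentiableAt.differentiableWithinAt
    · have h1 := ih (B.precompR E) hu.of_succ hv.2.2
      have h2 := ih (B.precompL E) hu.2.2 hv.of_succ
      rw [show s + (t - 1) = s + t - 1 by ring] at h1
      rw [show s - 1 + t = s + t - 1 by ring] at h2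
      refine (h1.add h2).congr fun x hx ↦ ?_
      exact (B.fderiv_of_bilinear (hu.differentiableAt hx) (hv.differentiableAt hx)).symm

theorem IsSymbol.const (c : F) : IsSymbol false k 0 (fun _ : E ↦ c) := by
  have hg : SymbolGrowth false 0 (fun _ : E ↦ c) := by
    simpa [SymbolGrowth] using isBigO_const_const c (one_ne_zero (α := ℝ)) (𝓝[≠] (0 : E))
  cases k with
  | zero => exact ⟨continuousOn_const, hg⟩
  | succ k =>
    refine ⟨differentiableOn_const _, hg, ?_⟩
    exact IsSymbol.zero.congr fun x _ ↦ by simp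

theorem ContinuousLinearMap.isSymbol (L : E →L[ℝ] F) : IsSymbol false k 1 (fun x ↦ L x) := by
  have hg : SymbolGrowth false 1 (fun x ↦ L x) := by
    simpa [SymbolGrowth] using (L.isBigO_id (𝓝[≠] 0)).norm_right
  cases k with
  | zero => exact ⟨L.continuous.continuousOn, hg⟩
  | succ k =>
    refine ⟨L.differentiable.differentiableOn, hg, ?_⟩
    rw [sub_self]
    exact (IsSymbol.const L).congr fun x _ ↦ L.fderiv.symm

/-- Since `ψ` scales norms by `c` and its derivative has order 0, the chain rule preserves orders
even if `ψ` is singular at the origin. -/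
theorem IsSymbol.comp {u : F → G} (hu : IsSymbol o k s u) {ψ : E → F} {c : ℝ} (hc : 0 < c)
    (hψ : ∀ x, ‖ψ x‖ = c * ‖x‖) (hψ' : ∀ k, IsSymbol false k 1 ψ) :
    IsSymbol o k s (fun x ↦ u (ψ x)) := by
  have hmaps : Set.MapsTo ψ {0}ᶜ {0}ᶜ := fun x hx ↦ by
    have : ‖ψ x‖ ≠ 0 := by
      rw [hψ]
      exact mul_ne_zero hc.ne' (norm_ne_zero_iff.2 hx)
    exact norm_ne_zero_iff.1 this
  induction k generalizing G s with
  | zero => exact ⟨hu.1.comp (hψ' 0).continuousOn hmaps, hu.2.comp hc hψ⟩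
  | succ k ih =>
    refine ⟨hu.1.comp (hψ' 1).1 hmaps, hu.2.1.comp hc hψ, ?_⟩
    have h := (ih hu.2.2).bilinear (ContinuousLinearMap.compL ℝ E F G) (hψ' (k + 1)).2.2
    rw [sub_self, add_zero] at h
    refine h.congr fun x hx ↦ ?_
    exact (fderiv_fun_comp x (hu.differentiableAt (hmaps hx)) ((hψ' 1).differentiableAt hx)).symm

/-- The decay forces a zero derivative at the origin, so `fderiv ℝ u` satisfies the same hypotheses
one order lower. The symbol condition ignores the value at 0, hence `h0`. -/
theorem IsSymbol.contDiff {u : E → F} (hu : IsSymbol true k k u) (h0 : u 0 = 0) :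
    ContDiff ℝ k u := by
  induction k generalizing F with
  | zero =>
    rw [Nat.cast_zero, contDiff_zero, continuous_iff_continuousAt]
    intro x
    by_cases hx : x = 0
    · subst hx
      have := hu.growth
      simp only [SymbolGrowth, if_true, Nat.cast_zero, zpow_zero] at this
      rw [continuousAt_iff_punctured_nhds, h0]
      exact (isLittleO_one_iff ℝ).1 this
    · exact hu.continuousOn.continuousAt (isOpen_compl_singleton.mem_nhds hx)
  | succ k ih =>
    have hd : HasFDerivAt u (0 : E →L[ℝ] F) 0 := by
      rw [hasFDerivAt_iff_isLittleO_nhds_zero]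
      have h1 : u =o[𝓝[≠] 0] (fun x ↦ ‖x‖ ^ (k + 1)) := by
        have := hu.growth
        simp only [SymbolGrowth, if_true] at this
        exact_mod_cast this
      have h2 : u =o[𝓝[≠] 0] (fun x ↦ x) := by
        refine h1.trans_isBigO (IsBigO.of_norm_right (IsBigO.of_bound 1 ?_))
        have hb : ∀ᶠ x : E in 𝓝[≠] 0, ‖x‖ ≤ 1 :=
          nhdsWithin_le_nhds ((continuous_norm.tendsto' 0 0 norm_zero).eventually_le_const
            zero_lt_one)
        filter_upwards [hb] with x hx
        rw [pow_succ, norm_mul, norm_norm, norm_pow, norm_norm]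
        exact mul_le_mul_of_nonneg_right (pow_le_one₀ (norm_nonneg x) hx) (norm_nonneg x)
      have h3 : u =o[𝓝 0] (fun x ↦ x) := by
        rw [← nhdsNE_sup_pure]
        refine h2.sup ?_
        rw [isLittleO_pure]
        exact h0
      simpa [h0] using h3
    have hdiff : Differentiable ℝ u := fun x ↦ by
      by_cases hx : x = 0
      · exact hx ▸ hd.differentiableAt
      · exact hu.differentiableAt hx
    have hu' := hu.2.2
    rw [Nat.cast_succ, add_sub_cancel_right] at hu'
    rw [Nat.cast_succ, contDiff_succ_iff_fderiv]
    exact ⟨hdiff, by simp, ih hu' hd.fderiv⟩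

/-- A `C^k` function all of whose derivatives of order at most `k` vanish at the origin is flat of
order `k` there. -/
theorem ContDiff.isSymbol_of_iteratedFDeriv_eq_zero {u : E → F} (hu : ContDiff ℝ k u)
    (h0 : ∀ j ≤ k, iteratedFDeriv ℝ j u 0 = 0) : IsSymbol true k k u := by
  have hu0 : u 0 = 0 := by
    have := congrArg (fun M ↦ M 0) (h0 0 (Nat.zero_le k))
    simpa using this
  induction k generalizing F with
  | zero =>
    refine ⟨hu.continuous.continuousOn, ?_⟩
    simp only [SymbolGrowth, if_true, Nat.cast_zero, zpow_zero, isLittleO_one_iff]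
    exact (hu.continuous.tendsto' 0 0 hu0).mono_left nhdsWithin_le_nhds
  | succ k ih =>
    have hd : Differentiable ℝ u := hu.differentiable (by simp)
    have hu' : ContDiff ℝ k (fderiv ℝ u) := hu.fderiv_right (by norm_cast)
    have h0' : ∀ j ≤ k, iteratedFDeriv ℝ j (fderiv ℝ u) 0 = 0 := fun j hj ↦ by
      rw [← norm_eq_zero, norm_iteratedFDeriv_fderiv, h0 (j + 1) (by omega), norm_zero]
    have hu0' : fderiv ℝ u 0 = 0 := by
      have := h0' 0 (Nat.zero_le k)
      rw [← norm_eq_zero, norm_iteratedFDeriv_zero] at this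
      exact norm_eq_zero.1 this
    have hs := ih hu' h0' hu0'
    refine ⟨hd.differentiableOn, ?_, by simpa using hs⟩
    have hg : fderiv ℝ u =o[𝓝 0] (fun x ↦ ‖x‖ ^ k) := by
      have := hs.growth
      simp only [SymbolGrowth, if_true, zpow_natCast] at this
      rw [← nhdsNE_sup_pure]
      refine this.sup ?_
      rw [isLittleO_pure]
      exact hu0'
    simp only [SymbolGrowth, if_true, zpow_natCast]
    refine IsLittleO.mono ?_ nhdsWithin_le_nhds
    refine isLittleO_iff.2 fun ε hε ↦ ?_
    obtain ⟨δ, hδ, hball⟩ := Metric.eventually_nhds_iff_ball.1 (isLittleO_iff.1 hg hε)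
    filter_upwards [Metric.ball_mem_nhds 0 hδ] with x hx
    have hx' : ‖x‖ < δ := by simpa using hx
    -- The mean value inequality on this ball gains the missing factor `‖x‖`.
    have := (convex_closedBall (0 : E) ‖x‖).norm_image_sub_le_of_norm_fderiv_le
      (f := u) (𝕜 := ℝ) (C := ε * ‖x‖ ^ k) (x := 0) (y := x) (fun y _ ↦ hd y)
      (fun y hy ↦ by
        have hy' : ‖y‖ ≤ ‖x‖ := by simpa using hy
        refine (hball y (by simpa using hy'.trans_lt hx')).trans ?_
        rw [norm_pow, norm_norm]
        gcongr)
      (by simp) (by simp)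
    rw [hu0, sub_zero, sub_zero, mul_assoc, ← pow_succ] at this
    rwa [norm_pow, norm_norm]

end Symbol

/-! ### Powers of the norm. -/

/-- The derivative of an integral power of the norm, away from the origin. -/
theorem hasFDerivAt_norm_zpow {E : Type*} [NormedAddCommGroup E] [InnerProductSpace ℝ E] (p : ℤ)
    {x : E} (hx : x ≠ 0) :
    HasFDerivAt (fun y : E ↦ ‖y‖ ^ p) (((p : ℝ) * ‖x‖ ^ (p - 2)) • innerSL ℝ x) x := by
  have hx' : ‖x‖ ≠ 0 := norm_ne_zero_iff.2 hx
  have h1 : HasFDerivAt (fun y : E ↦ Real.sqrt (‖y‖ ^ 2)) (‖x‖⁻¹ • innerSL ℝ x) x := by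
    convert (hasStrictFDerivAt_norm_sq x).hasFDerivAt.sqrt (by positivity) using 1
    rw [Real.sqrt_sq (norm_nonneg x), ← Nat.cast_smul_eq_nsmul ℝ, smul_smul]
    congr 1
    field_simp
    norm_num
  simp only [Real.sqrt_sq (norm_nonneg _)] at h1
  have h2 := (hasDerivAt_zpow p ‖x‖ (Or.inl hx')).comp_hasFDerivAt x h1
  refine HasFDerivAt.congr_fderiv (f := fun y : E ↦ ‖y‖ ^ p) h2 ?_
  rw [smul_smul, mul_assoc, ← zpow_sub_one₀ hx']
  ring_nf

theorem isSymbol_norm_zpow {E : Type} [NormedAddCommGroup E] [InnerProductSpace ℝ E] (k : ℕ)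
    (p : ℤ) : IsSymbol false k p (fun x : E ↦ ‖x‖ ^ p) := by
  have hg (p : ℤ) : SymbolGrowth false p (fun x : E ↦ ‖x‖ ^ p) := by
    simpa [SymbolGrowth] using Asymptotics.isBigO_refl _ _
  induction k generalizing p with
  | zero =>
    exact ⟨fun x hx ↦ (hasFDerivAt_norm_zpow p hx).continuousAt.continuousWithinAt, hg p⟩
  | succ k ih =>
    refine ⟨fun x hx ↦ (hasFDerivAt_norm_zpow p hx).differentiableAt.differentiableWithinAt,
      hg p, ?_⟩
    have h := (ih (p - 2)).bilinear (ContinuousLinearMap.lsmul ℝ ℝ)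
      (((p : ℝ) • innerSL ℝ (E := E)).isSymbol (k := k))
    rw [show p - 2 + 1 = p - 1 by ring] at h
    refine h.congr fun x hx ↦ ?_
    rw [(hasFDerivAt_norm_zpow p hx).fderiv]
    change ‖x‖ ^ (p - 2) • ((p : ℝ) • innerSL ℝ x) = _
    rw [smul_smul, mul_comm]

/-! ### Power series evaluated on operators. -/

section OperatorExtension

variable {ι : Type u} [Fintype ι] [DecidableEq ι]

/-- The extension of a real power series in finitely many variables to tuples of elements of a
normed algebra: the monomials are evaluated as ordered products. -/
noncomputable def FormalMultilinearSeries.algebraExtension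
    (p : FormalMultilinearSeries ℝ (EuclideanSpace ℝ ι) ℝ) (A : Type*) [NormedRing A]
    [NormedAlgebra ℝ A] : FormalMultilinearSeries ℝ (ι → A) A := fun m ↦
  ∑ σ : Fin m → ι, p m (fun i ↦ EuclideanSpace.single (σ i) 1) •
    (ContinuousMultilinearMap.mkPiAlgebraFin ℝ m A).compContinuousLinearMap
      (fun i ↦ ContinuousLinearMap.proj (R := ℝ) (φ := fun _ : ι ↦ A) (σ i))

theorem FormalMultilinearSeries.algebraExtension_apply
    (p : FormalMultilinearSeries ℝ (EuclideanSpace ℝ ι) ℝ) {A : Type*} [NormedRing A]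
    [NormedAlgebra ℝ A] (m : ℕ) (a : Fin m → ι → A) :
    p.algebraExtension A m a = ∑ σ : Fin m → ι,
      p m (fun i ↦ EuclideanSpace.single (σ i) 1) • (List.ofFn fun i ↦ a i (σ i)).prod := by
  rw [algebraExtension, sum_apply]
  rfl

theorem FormalMultilinearSeries.norm_algebraExtension_le
    (p : FormalMultilinearSeries ℝ (EuclideanSpace ℝ ι) ℝ) (A : Type*) [NormedRing A]
    [NormedAlgebra ℝ A] [NormOneClass A] (m : ℕ) :
    ‖p.algebraExtension A m‖ ≤ (Fintype.card ι : ℝ) ^ m * ‖p m‖ := by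
  refine ContinuousMultilinearMap.opNorm_le_bound (by positivity) fun a ↦ ?_
  rw [p.algebraExtension_apply]
  have hσ (σ : Fin m → ι) : ‖p m (fun i ↦ EuclideanSpace.single (σ i) 1) •
      (List.ofFn fun i ↦ a i (σ i)).prod‖ ≤ ‖p m‖ * ∏ i, ‖a i‖ := by
    refine (norm_smul_le _ _).trans ?_
    have h1 : ‖p m (fun i ↦ EuclideanSpace.single (σ i) (1 : ℝ))‖ ≤ ‖p m‖ := by
      simpa using (p m).le_opNorm (fun i ↦ EuclideanSpace.single (σ i) (1 : ℝ))
    refine mul_le_mul h1 ((List.norm_prod_le _).trans ?_) (norm_nonneg _) (norm_nonneg _)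
    rw [List.map_ofFn, List.prod_ofFn]
    exact Finset.prod_le_prod (fun _ _ ↦ norm_nonneg _) fun i _ ↦ norm_le_pi_norm (a i) (σ i)
  refine (norm_sum_le _ _).trans ((Finset.sum_le_sum fun σ _ ↦ hσ σ).trans ?_)
  simp [mul_assoc]

/-- On a common eigenvector every ordered product acts by the product of eigenvalues, so the
operators need not commute. -/
theorem FormalMultilinearSeries.algebraExtension_apply_eigenvector
    (p : FormalMultilinearSeries ℝ (EuclideanSpace ℝ ι) ℝ) {F : Type*} [NormedAddCommGroup F]
    [NormedSpace ℝ F] (a : ι → F →L[ℝ] F) (w : EuclideanSpace ℝ ι) (v : F)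
    (h : ∀ j, a j v = w j • v) (m : ℕ) :
    p.algebraExtension (F →L[ℝ] F) m (fun _ ↦ a) v = p m (fun _ ↦ w) • v := by
  have hprod (l : List ι) : (l.map a).prod v = (l.map fun j ↦ w j).prod • v := by
    induction l with
    | nil => simp
    | cons j l ih => simp [ih, h, smul_smul, mul_comm]
  have hw : w = ∑ j, w j • EuclideanSpace.single j (1 : ℝ) := by
    simpa using ((EuclideanSpace.basisFun ι ℝ).sum_repr w).symm
  have hp : p m (fun _ ↦ w) =
      ∑ σ : Fin m → ι, (∏ i, w (σ i)) * p m (fun i ↦ EuclideanSpace.single (σ i) 1) := by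
    conv_lhs => rw [hw]
    rw [(p m).map_sum]
    refine Finset.sum_congr rfl fun σ _ ↦ ?_
    rw [(p m).map_smul_univ, smul_eq_mul]
  rw [hp, Finset.sum_smul, p.algebraExtension_apply, sum_apply]
  refine Finset.sum_congr rfl fun σ _ ↦ ?_
  have := hprod (List.ofFn σ)
  rw [List.map_ofFn, List.map_ofFn, List.prod_ofFn (f := _ ∘ σ)] at this
  have hσ : (∏ i, w (σ i)) • v = (List.ofFn fun i ↦ a (σ i)).prod v := this.symm
  rw [mul_comm, mul_smul, hσ]
  rfl

/-- A function `f` of finitely many real variables that is analytic at the origin extends to an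
analytic function `Q` of tuples of operators, such that `Q a v = f w • v` for every common
eigenvector `v` with eigenvalues `w`. -/
theorem AnalyticAt.exists_operator_extension {f : EuclideanSpace ℝ ι → ℝ} (hf : AnalyticAt ℝ f 0)
    (F : Type u) [NormedAddCommGroup F] [NormedSpace ℝ F] [CompleteSpace F] [Nontrivial F] :
    ∃ ρ > 0, ∃ Q : (ι → F →L[ℝ] F) → F →L[ℝ] F, AnalyticOnNhd ℝ Q (Metric.ball 0 ρ) ∧
      ∀ a ∈ Metric.ball 0 ρ, ∀ w ∈ Metric.ball 0 ρ, ∀ v, (∀ j, a j v = w j • v) →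
        Q a v = f w • v := by
  obtain ⟨p, R, hp⟩ := hf
  obtain ⟨r, hr0, hrR⟩ := ENNReal.lt_iff_exists_nnreal_btwn.1 hp.r_pos
  have hr0' : 0 < r := by simpa using hr0
  obtain ⟨C, -, hC⟩ := p.norm_mul_pow_le_of_lt_radius (hrR.trans_le hp.r_le)
  set q := p.algebraExtension (F →L[ℝ] F)
  -- At most `(card ι) ^ m` monomials have degree `m`, so dividing the radius by `N` secures
  -- convergence; the `+ 1` covers empty `ι`.
  set N : NNReal := Fintype.card ι + 1
  have hN : 0 < N := by positivity
  have hN1 : 1 ≤ N := by simp [N]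
  have hρ : 0 < r / N := div_pos hr0' hN
  have hρr : r / N ≤ r := div_le_self hr0'.le hN1
  have hq : ((r / N : NNReal) : ENNReal) ≤ q.radius := by
    refine q.le_radius_of_bound C fun m ↦ le_trans ?_ (hC m)
    have hcard : (Fintype.card ι : ℝ) ≤ N := by simp [N]
    have hN' : (N : ℝ) ≠ 0 := by exact_mod_cast hN.ne'
    calc ‖q m‖ * ((r / N : NNReal) : ℝ) ^ m
        ≤ ((N : ℝ) ^ m * ‖p m‖) * ((r / N : NNReal) : ℝ) ^ m := by
          refine mul_le_mul_of_nonneg_right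
            ((p.norm_algebraExtension_le (F →L[ℝ] F) m).trans ?_) (by positivity)
          gcongr
      _ = ‖p m‖ * (r : ℝ) ^ m := by
          rw [NNReal.coe_div, div_pow]
          field_simp
  have hqs := (q.hasFPowerSeriesOnBall ((ENNReal.coe_pos.2 hρ).trans_le hq))
  have hball {X : Type u} [SeminormedAddCommGroup X] {x : X}
      (hx : x ∈ Metric.ball 0 ((r / N : NNReal) : ℝ)) :
      x ∈ Metric.eball 0 ((r / N : NNReal) : ENNReal) := by
    rwa [Metric.eball_coe]
  refine ⟨(r / N : NNReal), NNReal.coe_pos.2 hρ, q.sum, fun a ha ↦ ?_, fun a ha w hw v h ↦ ?_⟩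
  · exact hqs.analyticOnNhd a (Metric.eball_subset_eball hq (hball ha))
  · have h1 := hqs.hasSum (Metric.eball_subset_eball hq (hball ha))
    rw [zero_add] at h1
    have h2 := hp.hasSum (Metric.eball_subset_eball
      ((ENNReal.coe_le_coe.2 hρr).trans hrR.le) (hball hw))
    rw [zero_add] at h2
    have h3 := (ContinuousLinearMap.apply ℝ F v).hasSum h1
    have h4 := h2.smul_const v
    refine h3.unique ?_
    simpa [q, p.algebraExtension_apply_eigenvector a w v h] using h4

end OperatorExtension

/-! ### Parametrising the cone by space. -/

/-- The point `(t, x)` of `ℝⁿ⁺¹`. -/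
noncomputable def spacetimePoint {n : ℕ} (t : ℝ) (x : EuclideanSpace ℝ (Fin n)) :
    EuclideanSpace ℝ (Fin (n + 1)) :=
  WithLp.toLp 2 (Fin.cons t x : Fin (n + 1) → ℝ)

@[simp]
theorem spacetimePoint_zero {n : ℕ} (t : ℝ) (x : EuclideanSpace ℝ (Fin n)) :
    spacetimePoint t x 0 = t := rfl

@[simp]
theorem spacetimePoint_succ {n : ℕ} (t : ℝ) (x : EuclideanSpace ℝ (Fin n)) (i : Fin n) :
    spacetimePoint t x i.succ = x i := rfl

@[simp]
theorem spacetimePoint_zero_zero {n : ℕ} :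
    spacetimePoint 0 (0 : EuclideanSpace ℝ (Fin n)) = 0 := by
  ext i
  induction i using Fin.cases <;> simp

theorem norm_spacetimePoint {n : ℕ} {r : ℝ} {x : EuclideanSpace ℝ (Fin n)} (h : r ^ 2 = ‖x‖ ^ 2) :
    ‖spacetimePoint r x‖ = Real.sqrt 2 * ‖x‖ := by
  rw [← Real.sqrt_sq (norm_nonneg x), ← Real.sqrt_mul (by norm_num), EuclideanSpace.norm_eq]
  congr 1
  rw [Fin.sum_univ_succ]
  simp only [spacetimePoint_zero, spacetimePoint_succ, Real.norm_eq_abs, sq_abs]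
  rw [h, EuclideanSpace.real_norm_sq_eq]
  ring

theorem spacetimePoint_mul {n : ℕ} (ε r : ℝ) (x : EuclideanSpace ℝ (Fin n)) :
    spacetimePoint (ε * r) x = r • spacetimePoint ε 0 + spacetimePoint 0 x := by
  ext i
  induction i using Fin.cases <;> simp [mul_comm]

/-- The inclusion of space into spacetime, as a linear map. -/
noncomputable def spatialInclusion (n : ℕ) :
    EuclideanSpace ℝ (Fin n) →L[ℝ] EuclideanSpace ℝ (Fin (n + 1)) :=
  LinearMap.toContinuousLinearMap
    { toFun := spacetimePoint 0
      map_add' := fun x y ↦ by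
        ext i
        induction i using Fin.cases <;> simp
      map_smul' := fun c x ↦ by
        ext i
        induction i using Fin.cases <;> simp }

theorem spatialInclusion_apply {n : ℕ} (x : EuclideanSpace ℝ (Fin n)) :
    spatialInclusion n x = spacetimePoint 0 x := rfl

theorem contDiffAt_spacetimePoint {n : ℕ} {m : WithTop ℕ∞} {t : EuclideanSpace ℝ (Fin n) → ℝ}
    {x : EuclideanSpace ℝ (Fin n)} (ht : ContDiffAt ℝ m t x) :
    ContDiffAt ℝ m (fun y ↦ spacetimePoint (t y) y) x := by
  have : (fun y ↦ spacetimePoint (t y) y) = fun y : EuclideanSpace ℝ (Fin n) ↦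
      t y • spacetimePoint 1 0 + spatialInclusion n y := by
    funext y
    rw [spatialInclusion_apply, ← spacetimePoint_mul, one_mul]
  rw [this]
  exact (ht.smul contDiffAt_const).add (spatialInclusion n).contDiff.contDiffAt

theorem isSymbol_spacetimePoint {n : ℕ} (ε : ℝ) (k : ℕ) :
    IsSymbol false k 1 (fun x : EuclideanSpace ℝ (Fin n) ↦ spacetimePoint (ε * ‖x‖) x) := by
  have h := (isSymbol_norm_zpow (E := EuclideanSpace ℝ (Fin n)) k 1).bilinear
    (ContinuousLinearMap.lsmul ℝ ℝ) (IsSymbol.const (k := k) (spacetimePoint ε (n := n) 0))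
  rw [add_zero] at h
  refine (h.add (spatialInclusion n).isSymbol).congr fun x _ ↦ ?_
  simp [spacetimePoint_mul, spatialInclusion_apply]

/-- A function flat of order `k` at the vertex restricts to one on either half of the cone. -/
theorem IsSymbol.comp_spacetimePoint {n : ℕ} {o : Bool} {k : ℕ} {s : ℤ}
    {u : EuclideanSpace ℝ (Fin (n + 1)) → ℝ} (hu : IsSymbol o k s u) {ε : ℝ} (hε : ε ^ 2 = 1) :
    IsSymbol o k s (fun x ↦ u (spacetimePoint (ε * ‖x‖) x)) :=
  hu.comp (by positivity : 0 < Real.sqrt 2)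
    (fun x ↦ norm_spacetimePoint (by rw [mul_pow, hε, one_mul])) (isSymbol_spacetimePoint ε)

/-! ### Splittings on the double cone. -/

/-- `f = φ₁ + w⁰ φ₂` on the double cone `(w⁰)² = |w⃗|²`. -/
def IsConeSplitting {n : ℕ} (f : EuclideanSpace ℝ (Fin (n + 1)) → ℝ)
    (φ₁ φ₂ : EuclideanSpace ℝ (Fin n) → ℝ) : Prop :=
  ∀ x r, r ^ 2 = ‖x‖ ^ 2 → f (spacetimePoint r x) = φ₁ x + r * φ₂ x

open Filter Topology in
/-- Near the vertex, an analytic function has an analytic splitting on the double cone. -/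
theorem AnalyticAt.exists_local_coneSplitting {n : ℕ} {f : EuclideanSpace ℝ (Fin (n + 1)) → ℝ}
    (hf : AnalyticAt ℝ f 0) :
    ∃ φ₁ φ₂ : EuclideanSpace ℝ (Fin n) → ℝ, AnalyticAt ℝ φ₁ 0 ∧ AnalyticAt ℝ φ₂ 0 ∧
      ∀ᶠ x in 𝓝 0, ∀ r, r ^ 2 = ‖x‖ ^ 2 → f (spacetimePoint r x) = φ₁ x + r * φ₂ x := by
  obtain ⟨ρ, hρ, Q, hQ, hQf⟩ := hf.exists_operator_extension (ℝ × ℝ)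
  set N₁ : ℝ × ℝ →L[ℝ] ℝ × ℝ :=
    (ContinuousLinearMap.inl ℝ ℝ ℝ).comp (ContinuousLinearMap.snd ℝ ℝ ℝ) with hN₁
  set N₂ : ℝ × ℝ →L[ℝ] ℝ × ℝ :=
    (ContinuousLinearMap.inr ℝ ℝ ℝ).comp (ContinuousLinearMap.fst ℝ ℝ ℝ) with hN₂
  -- The matrix `(‖x‖² / δ) N₁ + δ N₂` sends `(r, δ)` to `(r², δ r) = r (r, δ)`. At `x = 0` only `δ
  -- N₂` remains, and a small `δ` puts it in the domain of `Q`.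
  obtain ⟨δ, hδ, hδρ⟩ : ∃ δ > 0, δ * ‖N₂‖ < ρ := by
    refine ⟨ρ / (‖N₂‖ + 1), by positivity, ?_⟩
    rw [div_mul_eq_mul_div, div_lt_iff₀ (by positivity)]
    nlinarith
  set a : EuclideanSpace ℝ (Fin n) → Fin (n + 1) → ℝ × ℝ →L[ℝ] ℝ × ℝ := fun x ↦
    Fin.cons ((‖x‖ ^ 2 / δ) • N₁ + δ • N₂) (fun j ↦ x j • 1) with ha
  have haan : ContDiff ℝ ω a := by
    rw [contDiff_pi]
    intro j
    induction j using Fin.cases with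
    | zero =>
      simp only [ha, Fin.cons_zero]
      exact (((contDiff_norm_sq ℝ).div_const δ).smul contDiff_const).add contDiff_const
    | succ j =>
      simp only [ha, Fin.cons_succ]
      exact (EuclideanSpace.proj (𝕜 := ℝ) j).contDiff.smul contDiff_const
  have ha0 : a 0 ∈ Metric.ball 0 ρ := by
    rw [mem_ball_zero_iff, pi_norm_lt_iff hρ]
    intro j
    induction j using Fin.cases with
    | zero => simpa [ha, norm_smul, abs_of_pos hδ] using hδρ
    | succ j => simpa [ha] using hρ
  have hQa : AnalyticAt ℝ (fun x ↦ Q (a x)) 0 := (hQ _ ha0).comp haan.contDiffAt.analyticAt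
  have hv (v : ℝ × ℝ) : AnalyticAt ℝ (fun x ↦ (Q (a x) v).2) 0 :=
    (((ContinuousLinearMap.snd ℝ ℝ ℝ).comp (ContinuousLinearMap.apply ℝ (ℝ × ℝ) v)).analyticAt
      _).comp hQa
  refine ⟨fun x ↦ (Q (a x) (0, 1)).2, fun x ↦ (Q (a x) (1, 0)).2 / δ, hv _, (hv _).div_const, ?_⟩
  have h1 : ∀ᶠ x in 𝓝 0, a x ∈ Metric.ball 0 ρ :=
    haan.continuous.continuousAt.eventually_mem (Metric.isOpen_ball.mem_nhds ha0)
  have h2 : ∀ᶠ x : EuclideanSpace ℝ (Fin n) in 𝓝 0, Real.sqrt 2 * ‖x‖ < ρ :=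
    ((continuous_const.mul continuous_norm).tendsto' 0 0 (by simp)).eventually_lt_const hρ
  filter_upwards [h1, h2] with x hx1 hx2 r hr
  have h := hQf (a x) hx1 (spacetimePoint r x)
    (by rwa [mem_ball_zero_iff, norm_spacetimePoint hr]) (r, δ) (fun j ↦ by
      induction j using Fin.cases with
      | zero =>
        simp only [ha, Fin.cons_zero, hN₁, hN₂, ← hr]
        ext
        · simp [field]
        · simp [mul_comm]
      | succ j => simp [ha])
  -- As `Q (a x)` does not involve `r`, linearity exhibits the dependence on `r`; the second
  -- coordinate of the eigenvector is the nonzero constant `δ`.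
  have hsplit : ((r, δ) : ℝ × ℝ) = r • ((1, 0) : ℝ × ℝ) + δ • ((0, 1) : ℝ × ℝ) := by simp
  rw [hsplit, map_add, map_smul, map_smul, ← hsplit] at h
  have h' := congrArg Prod.snd h
  simp only [Prod.snd_add, Prod.smul_snd, smul_eq_mul] at h'
  field_simp
  linarith

theorem IsConeSplitting.eq_even_part {n : ℕ} {f : EuclideanSpace ℝ (Fin (n + 1)) → ℝ}
    {φ₁ φ₂ : EuclideanSpace ℝ (Fin n) → ℝ} (h : IsConeSplitting f φ₁ φ₂)
    (x : EuclideanSpace ℝ (Fin n)) :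
    φ₁ x = (f (spacetimePoint ‖x‖ x) + f (spacetimePoint (-‖x‖) x)) / 2 := by
  rw [h x ‖x‖ rfl, h x (-‖x‖) (neg_sq _)]
  ring

theorem IsConeSplitting.eq_odd_part {n : ℕ} {f : EuclideanSpace ℝ (Fin (n + 1)) → ℝ}
    {φ₁ φ₂ : EuclideanSpace ℝ (Fin n) → ℝ} (h : IsConeSplitting f φ₁ φ₂)
    {x : EuclideanSpace ℝ (Fin n)} (hx : x ≠ 0) :
    φ₂ x = (f (spacetimePoint ‖x‖ x) - f (spacetimePoint (-‖x‖) x)) / (2 * ‖x‖) := by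
  rw [h x ‖x‖ rfl, h x (-‖x‖) (neg_sq _)]
  field_simp [norm_ne_zero_iff.2 hx]
  ring

open Filter Topology in
theorem AnalyticOnNhd.exists_coneSplitting {n : ℕ} {f : EuclideanSpace ℝ (Fin (n + 1)) → ℝ}
    (hf : AnalyticOnNhd ℝ f Set.univ) :
    ∃ φ₁ φ₂ : EuclideanSpace ℝ (Fin n) → ℝ, AnalyticOnNhd ℝ φ₁ Set.univ ∧
      AnalyticOnNhd ℝ φ₂ Set.univ ∧ IsConeSplitting f φ₁ φ₂ := by
  classical
  obtain ⟨ψ₁, ψ₂, hψ₁, hψ₂, hψ⟩ := (hf 0 trivial).exists_local_coneSplitting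
  set φ₁ : EuclideanSpace ℝ (Fin n) → ℝ := fun x ↦
    (f (spacetimePoint ‖x‖ x) + f (spacetimePoint (-‖x‖) x)) / 2 with hφ₁
  -- The quotient has no meaning at 0; the local splitting supplies its analytic continuation there.
  set φ₂ : EuclideanSpace ℝ (Fin n) → ℝ := fun x ↦ if x = 0 then ψ₂ 0 else
    (f (spacetimePoint ‖x‖ x) - f (spacetimePoint (-‖x‖) x)) / (2 * ‖x‖) with hφ₂
  have h1 : ψ₁ =ᶠ[𝓝 0] φ₁ := by
    filter_upwards [hψ] with x hx
    rw [hφ₁]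
    simp only
    rw [hx ‖x‖ rfl, hx (-‖x‖) (neg_sq _)]
    ring
  have h2 : ψ₂ =ᶠ[𝓝 0] φ₂ := by
    filter_upwards [hψ] with x hx
    by_cases h0 : x = 0
    · simp [hφ₂, h0]
    · simp only [hφ₂, if_neg h0]
      rw [hx ‖x‖ rfl, hx (-‖x‖) (neg_sq _)]
      field_simp [norm_ne_zero_iff.2 h0]
      ring
  have hf' : ContDiff ℝ ω f := contDiff_omega_iff_analyticOnNhd.2 hf
  have hnorm {x : EuclideanSpace ℝ (Fin n)} (hx : x ≠ 0) : ContDiffAt ℝ ω norm x :=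
    contDiffAt_norm ℝ hx
  have hp {x : EuclideanSpace ℝ (Fin n)} (hx : x ≠ 0) :
      ContDiffAt ℝ ω (fun y ↦ f (spacetimePoint ‖y‖ y)) x :=
    hf'.contDiffAt.comp x (contDiffAt_spacetimePoint (hnorm hx))
  have hm {x : EuclideanSpace ℝ (Fin n)} (hx : x ≠ 0) :
      ContDiffAt ℝ ω (fun y ↦ f (spacetimePoint (-‖y‖) y)) x :=
    hf'.contDiffAt.comp x (contDiffAt_spacetimePoint (hnorm hx).neg)
  refine ⟨φ₁, φ₂, fun x _ ↦ ?_, fun x _ ↦ ?_, fun x r hr ↦ ?_⟩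
  · by_cases hx : x = 0
    · exact hx ▸ hψ₁.congr h1
    · exact (((hp hx).add (hm hx)).div_const 2).analyticAt
  · by_cases hx : x = 0
    · exact hx ▸ hψ₂.congr h2
    · refine AnalyticAt.congr (((hp hx).sub (hm hx)).div (contDiffAt_const.mul (hnorm hx))
        (mul_ne_zero two_ne_zero (norm_ne_zero_iff.2 hx))).analyticAt ?_
      filter_upwards [isOpen_compl_singleton.mem_nhds hx] with y hy
      exact (if_neg hy).symm
  · by_cases hx : x = 0
    · subst hx
      obtain rfl : r = 0 := by simpa using hr
      simp [hφ₁]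
    · have hx' := norm_ne_zero_iff.2 hx
      simp only [hφ₁, hφ₂, if_neg hx]
      obtain rfl | rfl := sq_eq_sq_iff_eq_or_eq_neg.1 hr
      · field_simp
        ring
      · field_simp
        ring

/-- A `C^k` function is the sum of an entire analytic function and a remainder that is flat of order
`k` at the origin. -/
theorem ContDiff.exists_analyticOnNhd_add_flat {E F : Type} [NormedAddCommGroup E]
    [NormedSpace ℝ E] [NormedAddCommGroup F] [NormedSpace ℝ F] [CompleteSpace F] {k : ℕ}
    {f : E → F} (hf : ContDiff ℝ k f) :
    ∃ P R : E → F, AnalyticOnNhd ℝ P Set.univ ∧ IsSymbol true k k R ∧ R 0 = 0 ∧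
      ∀ w, f w = P w + R w := by
  obtain ⟨P, hP, hPf⟩ := hf.exists_analyticOnNhd_iteratedFDeriv_eq
  have hPk : ContDiff ℝ k P := hP.contDiff
  have hR (j : ℕ) (hj : j ≤ k) : iteratedFDeriv ℝ j (f - P) 0 = 0 := by
    rw [iteratedFDeriv_sub_apply (hf.of_le (by exact_mod_cast hj)).contDiffAt
      (hPk.of_le (by exact_mod_cast hj)).contDiffAt, hPf j hj, sub_self]
  refine ⟨P, f - P, hP, (hf.sub hPk).isSymbol_of_iteratedFDeriv_eq_zero hR, ?_, fun w ↦ by simp⟩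
  have := congrArg (fun M ↦ M 0) (hR 0 (Nat.zero_le k))
  simpa using this

/-- The restriction of a `C^k` function to one half of the cone has a `C^k` splitting. -/
theorem ContDiff.exists_half_coneSplitting {n k : ℕ} {f : EuclideanSpace ℝ (Fin (n + 1)) → ℝ}
    (hf : ContDiff ℝ k f) :
    ∃ φ₁ φ₂ : EuclideanSpace ℝ (Fin n) → ℝ, ContDiff ℝ k φ₁ ∧ ContDiff ℝ k φ₂ ∧
      ∀ x, f (spacetimePoint ‖x‖ x) = φ₁ x + ‖x‖ * φ₂ x := by
  obtain ⟨P, R, hP, hR, hR0, hfPR⟩ := hf.exists_analyticOnNhd_add_flat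
  obtain ⟨p₁, p₂, hp₁, hp₂, hp⟩ := hP.exists_coneSplitting
  have hu := (hR.comp_spacetimePoint (one_pow 2)).contDiff (by simpa using hR0)
  -- With only one half of the cone, the whole remainder goes into `φ₁`: no division by `‖x‖`, hence
  -- no loss of a derivative.
  refine ⟨fun x ↦ p₁ x + R (spacetimePoint (1 * ‖x‖) x), p₂,
    hp₁.contDiff.add hu, hp₂.contDiff, fun x ↦ ?_⟩
  simp only [one_mul]
  rw [hfPR, hp x ‖x‖ rfl]
  ring

/-- A function of class `C^(k+1)` has a `C^k` splitting on the double cone. -/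
theorem ContDiff.exists_coneSplitting {n k : ℕ} {f : EuclideanSpace ℝ (Fin (n + 1)) → ℝ}
    (hf : ContDiff ℝ (k + 1 : ℕ) f) :
    ∃ φ₁ φ₂ : EuclideanSpace ℝ (Fin n) → ℝ, ContDiff ℝ k φ₁ ∧ ContDiff ℝ k φ₂ ∧
      IsConeSplitting f φ₁ φ₂ := by
  obtain ⟨P, R, hP, hR, hR0, hfPR⟩ := hf.exists_analyticOnNhd_add_flat
  obtain ⟨p₁, p₂, hp₁, hp₂, hp⟩ := hP.exists_coneSplitting
  have hs (ε : ℝ) (hε : ε ^ 2 = 1) := hR.comp_spacetimePoint hε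
  have hu (ε : ℝ) (hε : ε ^ 2 = 1) :
      ContDiff ℝ k (fun x ↦ R (spacetimePoint (ε * ‖x‖) x)) :=
    ((hs ε hε).contDiff (by simpa using hR0)).of_le (by norm_cast; omega)
  -- Dividing by `‖x‖` lowers the flatness from `k + 1` to `k`.
  have hv (ε : ℝ) (hε : ε ^ 2 = 1) :
      ContDiff ℝ k (fun x ↦ R (spacetimePoint (ε * ‖x‖) x) * ‖x‖ ^ (-1 : ℤ)) := by
    have h := (hs ε hε).of_succ.bilinear (ContinuousLinearMap.mul ℝ ℝ)
      (isSymbol_norm_zpow k (-1))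
    rw [Nat.cast_succ, add_neg_cancel_right] at h
    exact h.contDiff (by simp)
  have h1 : (1 : ℝ) ^ 2 = 1 := one_pow 2
  have h2 : (-1 : ℝ) ^ 2 = 1 := by norm_num
  refine ⟨_, _, hp₁.contDiff.add (((hu 1 h1).add (hu (-1) h2)).div_const 2),
    hp₂.contDiff.add (((hv 1 h1).sub (hv (-1) h2)).div_const 2), fun x r hr ↦ ?_⟩
  rw [hfPR, hp x r hr]
  simp only [one_mul, neg_one_mul, zpow_neg_one]
  by_cases hx : x = 0
  · subst hx
    obtain rfl : r = 0 := by simpa using hr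
    simp
  · have hx' := norm_ne_zero_iff.2 hx
    obtain rfl | rfl := sq_eq_sq_iff_eq_or_eq_neg.1 hr
    · field_simp
      ring
    · field_simp
      ring

/-- A smooth function has a smooth splitting on the double cone. -/
theorem ContDiff.exists_smooth_coneSplitting {n : ℕ} {f : EuclideanSpace ℝ (Fin (n + 1)) → ℝ}
    (hf : ContDiff ℝ ∞ f) :
    ∃ φ₁ φ₂ : EuclideanSpace ℝ (Fin n) → ℝ, ContDiff ℝ ∞ φ₁ ∧ ContDiff ℝ ∞ φ₂ ∧
      IsConeSplitting f φ₁ φ₂ := by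
  choose φ₁ φ₂ h₁ h₂ h using fun k : ℕ ↦
    (contDiff_infty.1 hf (k + 1)).exists_coneSplitting
  refine ⟨φ₁ 0, φ₂ 0, contDiff_infty.2 fun k ↦ ?_, contDiff_infty.2 fun k ↦ ?_, h 0⟩
  · have : φ₁ 0 = φ₁ k := funext fun x ↦ by rw [(h 0).eq_even_part, (h k).eq_even_part]
    exact this ▸ h₁ k
  -- Uniqueness of `φ₂` at 0 comes from continuity along nonzero points; for `n = 0` there are none,
  -- but everything is constant.
  · rcases subsingleton_or_nontrivial (EuclideanSpace ℝ (Fin n)) with _ | _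
    · have : φ₂ 0 = fun _ ↦ φ₂ 0 0 := funext fun x ↦ by rw [Subsingleton.elim x 0]
      rw [this]
      exact contDiff_const
    · have := Module.punctured_nhds_neBot ℝ (EuclideanSpace ℝ (Fin n)) 0
      have : φ₂ 0 = φ₂ k := (h₂ 0).continuous.ext_on (dense_compl_singleton 0) (h₂ k).continuous
        fun x hx ↦ by rw [(h 0).eq_odd_part hx, (h k).eq_odd_part hx]
      exact this ▸ h₂ k

/-! ### From the cone to spacetime and back. -/

theorem lightCone_apply_zero {n : ℕ} (w : lightCone n) :
    (w : EuclideanSpace ℝ (Fin (n + 1))) 0 =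
      ‖spatialPart (w : EuclideanSpace ℝ (Fin (n + 1)))‖ := by
  rw [EuclideanSpace.norm_eq]
  simp only [spatialPart, Real.norm_eq_abs, sq_abs]
  exact w.2

theorem lightCone_eq_spacetimePoint {n : ℕ} (w : lightCone n) :
    (w : EuclideanSpace ℝ (Fin (n + 1))) =
      spacetimePoint ‖spatialPart (w : EuclideanSpace ℝ (Fin (n + 1)))‖
        (spatialPart (w : EuclideanSpace ℝ (Fin (n + 1)))) := by
  ext i
  induction i using Fin.cases with
  | zero => exact lightCone_apply_zero w
  | succ i => rfl

theorem contDiff_spatialPart {n : ℕ} {m : WithTop ℕ∞} :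
    ContDiff ℝ m (spatialPart : EuclideanSpace ℝ (Fin (n + 1)) → EuclideanSpace ℝ (Fin n)) := by
  rw [contDiff_euclidean]
  exact fun i ↦ (EuclideanSpace.proj (𝕜 := ℝ) i.succ).contDiff

/-- A decomposition on the cone provides an extension to spacetime. -/
theorem HasConeDecomposition.exists_extension {n : ℕ} {m : WithTop ℕ∞} {φ : lightCone n → ℝ}
    (h : HasConeDecomposition (fun g ↦ ContDiff ℝ m g) φ) :
    ∃ f : EuclideanSpace ℝ (Fin (n + 1)) → ℝ, ContDiff ℝ m f ∧ ∀ w : lightCone n, f w = φ w := by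
  obtain ⟨φ₁, φ₂, h₁, h₂, h⟩ := h
  refine ⟨fun w ↦ φ₁ (spatialPart w) + w 0 * φ₂ (spatialPart w),
    (h₁.comp contDiff_spatialPart).add ((EuclideanSpace.proj (𝕜 := ℝ) 0).contDiff.mul
      (h₂.comp contDiff_spatialPart)), fun w ↦ ?_⟩
  simp only [h, lightCone_apply_zero]

theorem HasConeDecomposition.of_splitting {n : ℕ} {P : (EuclideanSpace ℝ (Fin n) → ℝ) → Prop}
    {φ : lightCone n → ℝ} {f : EuclideanSpace ℝ (Fin (n + 1)) → ℝ}
    (hf : ∀ w : lightCone n, f w = φ w)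
    (h : ∃ φ₁ φ₂ : EuclideanSpace ℝ (Fin n) → ℝ, P φ₁ ∧ P φ₂ ∧
      ∀ x, f (spacetimePoint ‖x‖ x) = φ₁ x + ‖x‖ * φ₂ x) : HasConeDecomposition P φ := by
  obtain ⟨φ₁, φ₂, h₁, h₂, h⟩ := h
  exact ⟨φ₁, φ₂, h₁, h₂, fun w ↦ by rw [← h, ← lightCone_eq_spacetimePoint, hf]⟩

theorem mainTheorem4 (n : ℕ) (φ : lightCone n → ℝ) :
    (∀ k : ℕ,
      (∃ f : EuclideanSpace ℝ (Fin (n + 1)) → ℝ,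
        ContDiff ℝ k f ∧ ∀ w : lightCone n, f w = φ w) ↔ IsConeCk k φ) ∧
    ((∃ f : EuclideanSpace ℝ (Fin (n + 1)) → ℝ,
        ContDiff ℝ ∞ f ∧ ∀ w : lightCone n, f w = φ w) ↔ IsConeSmooth φ) ∧
    ((∃ f : EuclideanSpace ℝ (Fin (n + 1)) → ℝ,
        AnalyticOnNhd ℝ f Set.univ ∧ ∀ w : lightCone n, f w = φ w) ↔ IsConeAnalytic φ) := by
  refine ⟨fun k ↦ ⟨?_, fun h ↦ h.exists_extension⟩, ⟨?_, fun h ↦ h.exists_extension⟩,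
    ⟨?_, fun h ↦ ?_⟩⟩
  · rintro ⟨f, hf, hfφ⟩
    exact .of_splitting hfφ hf.exists_half_coneSplitting
  · rintro ⟨f, hf, hfφ⟩
    obtain ⟨φ₁, φ₂, h₁, h₂, h⟩ := hf.exists_smooth_coneSplitting
    exact .of_splitting hfφ ⟨φ₁, φ₂, h₁, h₂, fun x ↦ h x ‖x‖ rfl⟩
  · rintro ⟨f, hf, hfφ⟩
    obtain ⟨φ₁, φ₂, h₁, h₂, h⟩ := hf.exists_coneSplitting
    exact .of_splitting hfφ ⟨φ₁, φ₂, h₁, h₂, fun x ↦ h x ‖x‖ rfl⟩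
  · simp only [IsConeAnalytic, ← contDiff_omega_iff_analyticOnNhd] at h ⊢
    exact h.exists_extension
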